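/- **Diagrams.** An (oriented) tangle diagram is obtained by pasting, vertically and horizontally, vertical strands, real crossings of both types, local maxima and local minima, all arbitrarily oriented; it is put in general position with respect to height, so that each horizontal layer holds exactly one crossing, maximum or minimum. A colored diagram is built in the same way from strands that are in addition thin or thick, and may also use virtual crossings, called symmetries. All moves are local and fix the boundary. *Planar isotopy* of (tangle or colored) diagrams is generated by: exchanging the heights of two pieces lying side by side; creating or cancelling a maximum–minimum pair on a strand (both zigzags); passing a crossing (or symmetry) through a local maximum or minimum, from one leg to the other. *Reidemeister II (RII)* cancels two consecutive opposite crossings of two strands. *Reidemeister III (RIII)* slides the third of three strands lying at three different heights across the crossing of the other two. *Regular isotopy* $\sim_{RII,RIII}$ is the equivalence relation on tangle diagrams generated by RII, RIII and planar isotopies, for all orientations. An RIII move is *standard* if it has the form $\sigma_1\sigma_2\sigma_1\leftrightarrow\sigma_2\sigma_1\sigma_2$, where $\sigma_i$ is the crossing whose over-strand runs between the top right and the bottom left (a positive crossing if both strands are oriented downwards), with arbitrary orientations of the strands. The *colored moves* are the following, with arbitrary orientations and thicknesses. - *Colored $(0,2)$ moves*: two consecutive opposite real crossings of two strands cancel.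 - *Colored Pachner $(2,3)$ moves*: as a standard RIII move with strands $a$ under $b$ under $c$, except that the crossing of $a$ and $c$ is real on one side of the move and a symmetry on the other. It is real where it lies on the left-hand side of $b$ if $b$ is thick, and where it lies on the right-hand side of $b$ if $b$ is thin (with respect to the orientation of $b$). - *Symmetry moves*: two consecutive symmetries of two strands cancel; a strand meeting two other strands only in symmetries slides across their crossing, real or virtual. - *Planar isotopies* of colored diagrams. Let $\sim_c$ be the equivalence relation on colored diagrams generated by all colored moves. For a tangle diagram $D$, let $\zeta(D)$ be the colored diagram obtained by replacing every strand by two parallel copies, the copy on the left with respect to the orientation being thick and the other one thin; thus every crossing becomes four crossings of the same type, and every maximum or minimum two nested ones. **Theorem 5.2.** Let $D$ and $D'$ be tangle diagrams with the same boundary. 1. If $D\sim_{RII,RIII}D'$, then $\zeta(D)\sim_c\zeta(D')$. 2. If $D$ and $D'$ are related by a planar isotopy move, then $\zeta(D)$ and $\zeta(D')$ are related by planar isotopies of colored diagrams. 3. If $D$ and $D'$ are related by one RII move, then $\zeta(D)$ can be transformed into $\zeta(D')$ by exactly four colored $(0,2)$ moves together with planar isotopies. 4. If $D$ and $D'$ are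 related by one standard RIII move, then $\zeta(D)$ can be transformed into $\zeta(D')$ by exactly eight colored Pachner $(2,3)$ moves together with planar isotopies. If they are related by an RIII move of any other form (with the three strands at arbitrary different heights), then $\zeta(D)$ can be transformed into $\zeta(D')$ by exactly eight colored Pachner $(2,3)$ moves together with planar isotopies and colored $(0,2)$ moves. -/

import Mathlib

/-!
Diagrams are read from top to bottom and are in general position with respect to the height
function: a diagram is a finite list of horizontal layers, each of which contains exactly one
fundamental piece (a crossing, a local maximum or a local minimum), with vertical strands on its
left and on its right.
-/

namespace ColoredDiagrams

/-- Direction of an oriented strand at a horizontal level. -/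
inductive Dir
  | down
  | up
  deriving DecidableEq

/-- The reversed direction. -/
def Dir.rev : Dir → Dir
  | .down => .up
  | .up => .down

/-- A strand meeting a horizontal level: its direction there and its colour in `γ`. -/
@[ext]
structure Strand (γ : Type) where
  dir : Dir
  col : γ
  deriving DecidableEq

/-- Same colour, opposite direction. -/
def Strand.rev {γ : Type} (x : Strand γ) : Strand γ := ⟨x.dir.rev, x.col⟩

/-- The planar types of a real crossing.  `rightOver`: the strand from the top right to the bottom
left is over (a positive crossing if both strands point downwards); `leftOver`: the strand from
the top left to the bottom right is over. -/
inductive RealCrossing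
  | rightOver
  | leftOver
  deriving DecidableEq

/-- The crossings of a coloured diagram: real crossings and the symmetry (virtual crossing). -/
inductive VirtCrossing
  | real (k : RealCrossing)
  | sym
  deriving DecidableEq

/-- `turn k` is the crossing type obtained by a quarter turn of the plane; equivalently, the type
in which the top left and the top right strand have exchanged their heights. -/
class Turn (κ : Type) where
  turn : κ → κ

instance : Turn RealCrossing where
  turn
    | .rightOver => .leftOver
    | .leftOver => .rightOver

instance : Turn VirtCrossing where
  turn
    | .real k => .real (Turn.turn k)
    | .sym => .sym

/-- Fundamental pieces.  `cross k l r`: the strand `l` runs from the top left to the bottom right,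
the strand `r` from the top right to the bottom left.  `max x`, `min x`: a local maximum, minimum
with left leg `x`. -/
inductive Piece (κ γ : Type)
  | cross (k : κ) (l r : Strand γ)
  | max (x : Strand γ)
  | min (x : Strand γ)

/-- The strands at the top of a piece, from left to right. -/
def Piece.dom {κ γ : Type} : Piece κ γ → List (Strand γ)
  | .cross _ l r => [l, r]
  | .max _ => []
  | .min x => [x, x.rev]

/-- The strands at the bottom of a piece, from left to right. -/
def Piece.cod {κ γ : Type} : Piece κ γ → List (Strand γ)
  | .cross _ l r => [r, l]
  | .max x => [x, x.rev]
  | .min _ => []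

/-- A piece with vertical strands on its left and on its right. -/
structure Layer (κ γ : Type) where
  left : List (Strand γ)
  piece : Piece κ γ
  right : List (Strand γ)

def Layer.dom {κ γ : Type} (s : Layer κ γ) : List (Strand γ) := s.left ++ s.piece.dom ++ s.right

def Layer.cod {κ γ : Type} (s : Layer κ γ) : List (Strand γ) := s.left ++ s.piece.cod ++ s.right

/-- `Connects v w s`: the layers `s` fit together from top to bottom, from the level `v` to `w`. -/
def Connects {κ γ : Type} (v w : List (Strand γ)) : List (Layer κ γ) → Prop
  | [] => v = w
  | a :: s => v = a.dom ∧ Connects a.cod w s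

/-- Diagrams with top boundary `v` and bottom boundary `w`. -/
@[ext]
structure Diagram (κ γ : Type) (v w : List (Strand γ)) where
  layers : List (Layer κ γ)
  connects : Connects v w layers

/-- Put vertical strands `L` on the left and `R` on the right of a layer. -/
def Layer.whisker {κ γ : Type} (L R : List (Strand γ)) (s : Layer κ γ) : Layer κ γ :=
  ⟨L ++ s.left, s.piece, s.right ++ R⟩

/-- Put vertical strands `L` on the left and `R` on the right of a stack of layers. -/
def whisker {κ γ : Type} (L R : List (Strand γ)) (s : List (Layer κ γ)) : List (Layer κ γ) :=
  s.map (Layer.whisker L R)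

/-- One application, in either direction, of a local move `M` somewhere inside a diagram. -/
def Step {κ γ : Type} {v w : List (Strand γ)} (M : List (Layer κ γ) → List (Layer κ γ) → Prop)
    (D D' : Diagram κ γ v w) : Prop :=
  ∃ (pre post s t : List (Layer κ γ)) (L R : List (Strand γ)), (M s t ∨ M t s) ∧
    D.layers = pre ++ whisker L R s ++ post ∧ D'.layers = pre ++ whisker L R t ++ post

/-- `Via n M N D D'`: `D` is transformed into `D'` by finitely many steps, exactly `n` of them
`M`-steps and all the others `N`-steps. -/
inductive Via {α : Type} (M N : α → α → Prop) : ℕ → α → α → Prop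
  | refl (D : α) : Via M N 0 D D
  | counted {n : ℕ} {D E F : α} (h : Via M N n D E) (hEF : M E F) : Via M N (n + 1) D F
  | free {n : ℕ} {D E F : α} (h : Via M N n D E) (hEF : N E F) : Via M N n D F

section Moves

variable {κ γ : Type}

/-- The planar isotopies: exchange of the heights of two pieces lying side by side, creation or
cancellation of a maximum and a minimum on a strand, and passage of a crossing through a local
maximum or minimum. -/
inductive Planar [Turn κ] : List (Layer κ γ) → List (Layer κ γ) → Prop
  | exchange (g h : Piece κ γ) (m : List (Strand γ)) :
      Planar [⟨[], g, m ++ h.dom⟩, ⟨g.cod ++ m, h, []⟩] [⟨g.dom ++ m, h, []⟩, ⟨[], g, m ++ h.cod⟩]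
  | zigzagLeft (x : Strand γ) : Planar [⟨[x], .max x.rev, []⟩, ⟨[], .min x, [x]⟩] []
  | zigzagRight (x : Strand γ) : Planar [⟨[], .max x, [x]⟩, ⟨[x], .min x.rev, []⟩] []
  | slideMax (k : κ) (x y : Strand γ) :
      Planar [⟨[y], .max x, []⟩, ⟨[], .cross k y x, [x.rev]⟩]
        [⟨[], .max x, [y]⟩, ⟨[x], .cross (Turn.turn k) x.rev y, []⟩]
  | slideMin (k : κ) (x y : Strand γ) :
      Planar [⟨[], .cross k x y, [x.rev]⟩, ⟨[y], .min x, []⟩]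
        [⟨[x], .cross (Turn.turn k) y x.rev, []⟩, ⟨[], .min x, [y]⟩]

/-- Strands `a`, `b`, `c` (in this order at the top) cross pairwise, with the strand `b` on the
left of the crossing of `a` and `c`. -/
def triLeft (kab kac kbc : κ) (a b c : Strand γ) : List (Layer κ γ) :=
  [⟨[], .cross kab a b, [c]⟩, ⟨[b], .cross kac a c, []⟩, ⟨[], .cross kbc b c, [a]⟩]

/-- Strands `a`, `b`, `c` (in this order at the top) cross pairwise, with the strand `b` on the
right of the crossing of `a` and `c`. -/
def triRight (kab kac kbc : κ) (a b c : Strand γ) : List (Layer κ γ) :=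
  [⟨[a], .cross kbc b c, []⟩, ⟨[], .cross kac a c, [b]⟩, ⟨[c], .cross kab a b, []⟩]

end Moves

/-- Oriented tangle diagrams; the strands carry no colour. -/
abbrev TangleDiagram (v w : List (Strand Unit)) : Type := Diagram RealCrossing Unit v w

/-- Reidemeister II, with arbitrary orientations. -/
inductive RII : List (Layer RealCrossing Unit) → List (Layer RealCrossing Unit) → Prop
  | mk (k : RealCrossing) (l r : Strand Unit) :
      RII [⟨[], .cross k l r, []⟩, ⟨[], .cross (Turn.turn k) r l, []⟩] []

/-- Reidemeister III, with arbitrary orientations.  The hypothesis says that `a`, `b`, `c` lie at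
three different heights, i.e. that "over" is not cyclic on them. -/
inductive RIII : List (Layer RealCrossing Unit) → List (Layer RealCrossing Unit) → Prop
  | mk (kab kac kbc : RealCrossing) (h : kab = kbc → kac = kab) (a b c : Strand Unit) :
      RIII (triLeft kab kac kbc a b c) (triRight kab kac kbc a b c)

/-- The standard form `σ₁σ₂σ₁ = σ₂σ₁σ₂` of Reidemeister III, with arbitrary orientations: the three
crossings are positive if all strands are oriented downwards. -/
inductive RIIIStd : List (Layer RealCrossing Unit) → List (Layer RealCrossing Unit) → Prop
  | mk (a b c : Strand Unit) :
      RIIIStd (triLeft .rightOver .rightOver .rightOver a b c)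
        (triRight .rightOver .rightOver .rightOver a b c)

/-- Regular isotopy of tangle diagrams. -/
def RegularIsotopic {v w : List (Strand Unit)} : TangleDiagram v w → TangleDiagram v w → Prop :=
  Relation.EqvGen fun D D' => Step Planar D D' ∨ Step RII D D' ∨ Step RIII D D'

inductive Thickness
  | thin
  | thick
  deriving DecidableEq

/-- Coloured diagrams. -/
abbrev ColoredDiagram (v w : List (Strand Thickness)) : Type := Diagram VirtCrossing Thickness v w

/-- Layers of coloured diagrams. -/
abbrev CLayer : Type := Layer VirtCrossing Thickness

/-- The coloured `(0,2)` moves: two consecutive opposite real crossings cancel, for all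
orientations and thicknesses. -/
inductive ZeroTwo : List CLayer → List CLayer → Prop
  | mk (k : RealCrossing) (l r : Strand Thickness) :
      ZeroTwo [⟨[], .cross (.real k) l r, []⟩, ⟨[], .cross (.real (Turn.turn k)) r l, []⟩] []

/-- For a middle strand `b`, the type of the crossing of the lowest and the highest strand in a
coloured Pachner move, when this crossing is on the right of `b` in the plane: it is real if it is
on the left hand side of a thick `b` or on the right hand side of a thin `b` with respect to the
orientation of `b`, and a symmetry otherwise. -/
def outerOnRight (b : Strand Thickness) : VirtCrossing :=
  match b.dir, b.col with
  | .down, .thin => .sym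
  | .down, .thick => .real .rightOver
  | .up, .thin => .real .rightOver
  | .up, .thick => .sym

/-- The same when the crossing of the lowest and the highest strand is on the left of `b`. -/
def outerOnLeft (b : Strand Thickness) : VirtCrossing :=
  match b.dir, b.col with
  | .down, .thin => .real .rightOver
  | .down, .thick => .sym
  | .up, .thin => .sym
  | .up, .thick => .real .rightOver

/-- The coloured Pachner `(2,3)` moves.  Here `a` is under `b`, and `b` is under `c`; on one side of
the move the crossing of `a` and `c` is real, on the other side it is a symmetry. Orientations
and thicknesses of `a` and `c` are arbitrary.  For strands oriented downwards, with labels read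
upwards, this is `S₂₃ S₁₂ = S₁₂ S₁₃ S₂₃` if `b` is thin and `S₂₃ S₁₃ S₁₂ = S₁₂ S₂₃` if `b` is thick,
where the strands 1, 2, 3 are `a`, `b`, `c`. -/
inductive Pachner : List CLayer → List CLayer → Prop
  | mk (a b c : Strand Thickness) :
      Pachner (triLeft (.real .rightOver) (outerOnRight b) (.real .rightOver) a b c)
        (triRight (.real .rightOver) (outerOnLeft b) (.real .rightOver) a b c)

/-- The symmetry moves: two consecutive symmetries cancel, and a strand that meets two other
strands only in symmetries slides across their crossing, real or virtual. (Sliding across local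
maxima and minima is in `Planar`.) -/
inductive SymMove : List CLayer → List CLayer → Prop
  | cancel (l r : Strand Thickness) :
      SymMove [⟨[], .cross .sym l r, []⟩, ⟨[], .cross .sym r l, []⟩] []
  | slideA (k : VirtCrossing) (a b c : Strand Thickness) :
      SymMove (triLeft .sym .sym k a b c) (triRight .sym .sym k a b c)
  | slideB (k : VirtCrossing) (a b c : Strand Thickness) :
      SymMove (triLeft .sym k .sym a b c) (triRight .sym k .sym a b c)
  | slideC (k : VirtCrossing) (a b c : Strand Thickness) :
      SymMove (triLeft k .sym .sym a b c) (triRight k .sym .sym a b c)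

/-- The equivalence relation `∼_c` generated by all coloured moves. -/
def ColoredEquiv {v w : List (Strand Thickness)} : ColoredDiagram v w → ColoredDiagram v w → Prop :=
  Relation.EqvGen fun Z Z' =>
    Step Pachner Z Z' ∨ Step ZeroTwo Z Z' ∨ Step SymMove Z Z' ∨ Step Planar Z Z'

/-- Of the two parallel copies of a strand, the copy on the left in the plane.  The thick copy is
the one on the left hand side with respect to the orientation. -/
def copyL (x : Strand Unit) : Strand Thickness :=
  ⟨x.dir, match x.dir with
    | .down => .thin
    | .up => .thick⟩

/-- Of the two parallel copies of a strand, the copy on the right in the plane. -/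
def copyR (x : Strand Unit) : Strand Thickness :=
  ⟨x.dir, match x.dir with
    | .down => .thick
    | .up => .thin⟩

/-- Doubling of a level. -/
def dbl (v : List (Strand Unit)) : List (Strand Thickness) :=
  v.flatMap fun x => [copyL x, copyR x]

/-- Doubling of a fundamental piece: a crossing becomes four crossings, a maximum or minimum two
nested ones. -/
def dblPiece : Piece RealCrossing Unit → List CLayer
  | .cross k l r =>
      [⟨[copyL l], .cross (.real k) (copyR l) (copyL r), [copyR r]⟩,
       ⟨[], .cross (.real k) (copyL l) (copyL r), [copyR l, copyR r]⟩,
       ⟨[copyL r, copyL l], .cross (.real k) (copyR l) (copyR r), []⟩,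
       ⟨[copyL r], .cross (.real k) (copyL l) (copyR r), [copyR l]⟩]
  | .max x => [⟨[], .max (copyL x), []⟩, ⟨[copyL x], .max (copyR x), [(copyL x).rev]⟩]
  | .min x => [⟨[copyL x], .min (copyR x), [(copyL x).rev]⟩, ⟨[], .min (copyL x), []⟩]

/-- Doubling of a layer. -/
def dblLayer (s : Layer RealCrossing Unit) : List CLayer :=
  whisker (dbl s.left) (dbl s.right) (dblPiece s.piece)

theorem Connects.append {κ γ : Type} {u v w : List (Strand γ)} {s t : List (Layer κ γ)}
    (hs : Connects u v s) (ht : Connects v w t) : Connects u w (s ++ t) := by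
  induction s generalizing u with
  | nil => cases hs; exact ht
  | cons a s ih => exact ⟨hs.1, ih hs.2⟩

theorem Connects.whisker {κ γ : Type} {v w : List (Strand γ)} {s : List (Layer κ γ)}
    (L R : List (Strand γ)) (hs : Connects v w s) :
    Connects (L ++ v ++ R) (L ++ w ++ R) (whisker L R s) := by
  induction s generalizing v with
  | nil => cases hs; rfl
  | cons a s ih =>
    refine ⟨?_, ?_⟩
    · rw [hs.1]; simp [Layer.dom, Layer.whisker]
    · have := ih hs.2
      simpa [Layer.cod, Layer.whisker, ColoredDiagrams.whisker] using this

theorem connects_dblPiece (g : Piece RealCrossing Unit) :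
    Connects (dbl g.dom) (dbl g.cod) (dblPiece g) := by
  cases g with
  | cross k l r => simp [dblPiece, dbl, Piece.dom, Piece.cod, Connects, Layer.dom, Layer.cod]
  | max x =>
    rcases x with ⟨d, c⟩
    cases d <;> simp [dblPiece, dbl, Piece.dom, Piece.cod, Connects, Layer.dom, Layer.cod,
      Strand.rev, Dir.rev, copyL, copyR]
  | min x =>
    rcases x with ⟨d, c⟩
    cases d <;> simp [dblPiece, dbl, Piece.dom, Piece.cod, Connects, Layer.dom, Layer.cod,
      Strand.rev, Dir.rev, copyL, copyR]

theorem connects_dbl {v w : List (Strand Unit)} {s : List (Layer RealCrossing Unit)}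
    (hs : Connects v w s) : Connects (dbl v) (dbl w) (s.flatMap dblLayer) := by
  induction s generalizing v with
  | nil => cases hs; rfl
  | cons a s ih =>
    rw [List.flatMap_cons]
    refine Connects.append ?_ (ih hs.2)
    rw [hs.1]
    have := (connects_dblPiece a.piece).whisker (dbl a.left) (dbl a.right)
    simpa [dblLayer, Layer.dom, Layer.cod, dbl] using this

/-- The coloured diagram `ζ(D)`: every strand of `D` is doubled, and the copy on the left hand side
with respect to the orientation is thickened. -/
def zeta {v w : List (Strand Unit)} (D : TangleDiagram v w) : ColoredDiagram (dbl v) (dbl w) :=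
  ⟨D.layers.flatMap dblLayer, connects_dbl D.connects⟩

end ColoredDiagrams

/-! All moves are local, and doubling commutes with stacking layers and with adding vertical
strands. So it suffices to deform the doubled left side of each generating move into the doubled
right side, with the right count (`Reach.via_zeta`).

A doubled planar isotopy splits into planar isotopies of the copies: stacks slide past each other
(`Reach.exchange_stacks`), a doubled zigzag is two nested zigzags, and a doubled slide is four
slides. A doubled RII move consists of four cancelling pairs, one for each copy of `l` and each copy
of `r`.

For the standard RIII move, both copies of the middle strand `b` are pushed across each of the four
crossings between a copy of `a` and a copy of `c`. One such passage costs two Pachner moves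
(`Reach.wide_pachner`): the two copies of `b` are parallel with opposite thickness, so the crossing
is real on both outer sides of the pair and a symmetry only between the copies. This gives 4 · 2 =
8.

Any other RIII move is a standard one conjugated by crossings, with RII moves inserting and
cancelling the conjugating pairs (`byOneStd_of_acyclic`). Exactly one standard move is used, so its
double costs eight Pachner moves, and the RII moves contribute only (0,2) moves and planar
isotopies. The symmetry moves are never needed. -/

namespace ColoredDiagrams

/-! ### Boundaries of stacks of layers and replacement of a substack. -/

section Stacks

variable {κ γ : Type}

theorem Connects.split {v w : List (Strand γ)} {s t : List (Layer κ γ)}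
    (h : Connects v w (s ++ t)) : ∃ u, Connects v u s ∧ Connects u w t := by
  induction s generalizing v with
  | nil => exact ⟨v, rfl, h⟩
  | cons a s ih =>
    obtain ⟨u, hs, ht⟩ := ih h.2
    exact ⟨u, ⟨h.1, hs⟩, ht⟩

theorem Connects.target_unique {v w w' : List (Strand γ)} {s : List (Layer κ γ)}
    (h : Connects v w s) (h' : Connects v w' s) : w = w' := by
  induction s generalizing v with
  | nil => exact h.symm.trans h'
  | cons a s ih => exact ih h.2 h'.2

theorem Connects.source_unique {v v' w w' : List (Strand γ)} {s : List (Layer κ γ)}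
    (hs : s ≠ []) (h : Connects v w s) (h' : Connects v' w' s) : v = v' := by
  cases s with
  | nil => exact absurd rfl hs
  | cons a s => exact h.1.trans h'.1.symm

theorem Connects.unwhisker_of_source {L R p u : List (Strand γ)} {s : List (Layer κ γ)}
    (h : Connects (L ++ p ++ R) u (ColoredDiagrams.whisker L R s)) :
    ∃ q, u = L ++ q ++ R ∧ Connects p q s := by
  induction s generalizing p with
  | nil => exact ⟨p, h.symm, rfl⟩
  | cons a s ih =>
    obtain ⟨h1, h2⟩ := h
    have hp : p = a.dom := by
      have h1' : L ++ p ++ R = L ++ a.dom ++ R := by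
        rw [h1]; simp [Layer.dom, Layer.whisker]
      exact List.append_cancel_left (List.append_cancel_right h1')
    have hc : (Layer.whisker L R a).cod = L ++ a.cod ++ R := by
      simp [Layer.cod, Layer.whisker]
    rw [hc] at h2
    obtain ⟨q, hq, hs⟩ := ih h2
    exact ⟨q, hq, hp, hs⟩

/-- The first layer displays `L` and `R` inside the level `v`. An empty stack fits at any level and
gives no such factorisation, which is the source of the nonemptiness hypotheses below. -/
theorem Connects.unwhisker {L R v w : List (Strand γ)} {s : List (Layer κ γ)} (hs : s ≠ [])
    (h : Connects v w (ColoredDiagrams.whisker L R s)) :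
    ∃ p q, v = L ++ p ++ R ∧ w = L ++ q ++ R ∧ Connects p q s := by
  cases s with
  | nil => exact absurd rfl hs
  | cons a s =>
    have hv : v = L ++ a.dom ++ R := by
      rw [h.1]; simp [Layer.dom, Layer.whisker]
    subst hv
    obtain ⟨q, hq, hc⟩ := h.unwhisker_of_source
    exact ⟨_, q, rfl, hq, hc⟩

theorem whisker_append (L R : List (Strand γ)) (s t : List (Layer κ γ)) :
    whisker L R (s ++ t) = whisker L R s ++ whisker L R t :=
  List.map_append

theorem whisker_whisker (L R L' R' : List (Strand γ)) (s : List (Layer κ γ)) :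
    whisker L R (whisker L' R' s) = whisker (L ++ L') (R' ++ R) s := by
  simp [whisker, Layer.whisker]

theorem whisker_nil_nil (s : List (Layer κ γ)) : whisker [] [] s = s := by
  induction s with
  | nil => rfl
  | cons a s ih => simpa [whisker, Layer.whisker] using ih

/-- Two stacks with the same boundary. -/
def Parallel (s t : List (Layer κ γ)) : Prop := ∃ p q, Connects p q s ∧ Connects p q t

theorem Parallel.symm {s t : List (Layer κ γ)} (h : Parallel s t) : Parallel t s :=
  let ⟨p, q, hs, ht⟩ := h
  ⟨p, q, ht, hs⟩

/-- A nonempty stack determines its boundary, so `s` has inside the diagram the same boundary that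
it shares with `t`. -/
theorem Connects.replace {v w : List (Strand γ)} {pre post s t : List (Layer κ γ)}
    {L R : List (Strand γ)} (hs : s ≠ []) (hst : Parallel s t)
    (h : Connects v w (pre ++ ColoredDiagrams.whisker L R s ++ post)) :
    Connects v w (pre ++ ColoredDiagrams.whisker L R t ++ post) := by
  obtain ⟨u', h0, h3⟩ := h.split
  obtain ⟨u, h1, h2'⟩ := h0.split
  obtain ⟨p, q, rfl, rfl, h2⟩ := h2'.unwhisker hs
  clear h2'
  obtain ⟨p', q', hs', ht'⟩ := hst
  obtain rfl := h2.source_unique hs hs'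
  obtain rfl := h2.target_unique hs'
  exact (h1.append (ht'.whisker L R)).append h3

/-- A step between stacks of layers with fixed boundary. -/
def StackStep (M : List (Layer κ γ) → List (Layer κ γ) → Prop) (v w : List (Strand γ))
    (s t : List (Layer κ γ)) : Prop :=
  ∃ (hs : Connects v w s) (ht : Connects v w t), Step M (⟨s, hs⟩ : Diagram κ γ v w) ⟨t, ht⟩

theorem Step.symm {v w : List (Strand γ)} {M : List (Layer κ γ) → List (Layer κ γ) → Prop}
    {D D' : Diagram κ γ v w} (h : Step M D D') : Step M D' D :=
  let ⟨pre, post, s, t, L, R, hM, hD, hD'⟩ := h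
  ⟨pre, post, t, s, L, R, hM.symm, hD', hD⟩

theorem StackStep.context {M : List (Layer κ γ) → List (Layer κ γ) → Prop}
    {v w p q L R : List (Strand γ)} {pre post s t : List (Layer κ γ)} (h : StackStep M p q s t)
    (hpre : Connects v (L ++ p ++ R) pre) (hpost : Connects (L ++ q ++ R) w post) :
    StackStep M v w (pre ++ whisker L R s ++ post) (pre ++ whisker L R t ++ post) := by
  obtain ⟨hs, ht, pre', post', a, b, L', R', hM, hD, hD'⟩ := h
  refine ⟨(hpre.append (hs.whisker L R)).append hpost,
    (hpre.append (ht.whisker L R)).append hpost, pre ++ whisker L R pre',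
    whisker L R post' ++ post, a, b, L ++ L', R' ++ R, hM, ?_, ?_⟩
  · dsimp only at hD ⊢
    simp [hD, whisker_append, whisker_whisker]
  · dsimp only at hD' ⊢
    simp [hD', whisker_append, whisker_whisker]

end Stacks

/-! ### Counted sequences of steps. -/

section Via

variable {α β : Type} {M N : α → α → Prop}

theorem Via.trans {m n : ℕ} {x y z : α} (h : Via M N m x y) (h' : Via M N n y z) :
    Via M N (m + n) x z := by
  induction h' with
  | refl => exact h
  | counted _ hEF ih => exact (ih h).counted hEF
  | free _ hEF ih => exact (ih h).free hEF

theorem Via.symm (hM : ∀ x y, M x y → M y x) (hN : ∀ x y, N x y → N y x) {n : ℕ} {x y : α}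
    (h : Via M N n x y) : Via M N n y x := by
  induction h with
  | refl => exact .refl _
  | @counted n D E F _ hEF ih =>
    -- `Via` grows at its end, so the reversed last step is put in front by `Via.trans`, with count
    -- `0 + 1 + n`.
    have := (Via.counted (N := N) (.refl F) (hM _ _ hEF)).trans ih
    rwa [Nat.zero_add, Nat.add_comm] at this
  | @free n D E F _ hEF ih =>
    have := (Via.free (M := M) (.refl F) (hN _ _ hEF)).trans ih
    rwa [Nat.zero_add] at this

/-- Used with `k = 1` to put deformations into a context, and with `k = 8` to double a sequence
containing one standard RIII move. -/
theorem Via.bind {M' N' : β → β → Prop} (f : α → β) {k : ℕ}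
    (hM : ∀ x y, M x y → Via M' N' k (f x) (f y)) (hN : ∀ x y, N x y → Via M' N' 0 (f x) (f y))
    {n : ℕ} {x y : α} (h : Via M N n x y) : Via M' N' (n * k) (f x) (f y) := by
  induction h with
  | refl => rw [Nat.zero_mul]; exact .refl _
  | counted _ hEF ih => rw [Nat.succ_mul]; exact ih.trans (hM _ _ hEF)
  | free _ hEF ih => exact ih.trans (hN _ _ hEF)

theorem Via.mono {M' N' : α → α → Prop} (hM : ∀ x y, M x y → M' x y)
    (hN : ∀ x y, N x y → N' x y) {n : ℕ} {x y : α} (h : Via M N n x y) : Via M' N' n x y := by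
  induction h with
  | refl => exact .refl _
  | counted _ hEF ih => exact ih.counted (hM _ _ hEF)
  | free _ hEF ih => exact ih.free (hN _ _ hEF)

theorem Via.discount {M' N' : α → α → Prop} (hM : ∀ x y, M x y → N' x y)
    (hN : ∀ x y, N x y → N' x y) {n : ℕ} {x y : α} (h : Via M N n x y) : Via M' N' 0 x y := by
  induction h with
  | refl => exact .refl _
  | counted _ hEF ih => exact ih.free (hM _ _ hEF)
  | free _ hEF ih => exact ih.free (hN _ _ hEF)

theorem Via.eqvGen {n : ℕ} {x y : α} (h : Via M N n x y) :
    Relation.EqvGen (fun x y => M x y ∨ N x y) x y := by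
  induction h with
  | refl => exact .refl _
  | counted _ hEF ih => exact ih.trans _ _ _ (.rel _ _ (.inl hEF))
  | free _ hEF ih => exact ih.trans _ _ _ (.rel _ _ (.inr hEF))

theorem Via.eqvGen_of_zero {x y : α} (h : Via M N 0 x y) : Relation.EqvGen N x y := by
  generalize hn : 0 = n at h
  induction h with
  | refl => exact .refl _
  | counted => omega
  | free _ hEF ih => exact (ih hn).trans _ _ _ (.rel _ _ hEF)

end Via

/-! ### Deformations of stacks, independent of the ambient boundary. -/

section Reach

variable {κ γ : Type} {M N : List (Layer κ γ) → List (Layer κ γ) → Prop}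

theorem Via.connects {v w : List (Strand γ)} {n : ℕ} {s t : List (Layer κ γ)}
    (h : Via (StackStep M v w) (StackStep N v w) n s t) (hs : Connects v w s) :
    Connects v w t := by
  cases h with
  | refl => exact hs
  | counted _ h => exact h.2.1
  | free _ h => exact h.2.1

theorem Via.toDiagram {v w : List (Strand γ)} {n : ℕ} {s t : List (Layer κ γ)}
    (h : Via (StackStep M v w) (StackStep N v w) n s t) (hs : Connects v w s)
    (ht : Connects v w t) :
    Via (Step M) (Step N) n (⟨s, hs⟩ : Diagram κ γ v w) ⟨t, ht⟩ := by
  induction h with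
  | refl => exact .refl _
  | counted _ h ih => exact (ih hs h.1).counted h.2.2
  | free _ h ih => exact (ih hs h.1).free h.2.2

/-- The stack `s`, whatever its boundary is, can be transformed into `t` by `n` moves `M` and
arbitrarily many moves `N`. -/
def Reach (M N : List (Layer κ γ) → List (Layer κ γ) → Prop) (n : ℕ)
    (s t : List (Layer κ γ)) : Prop :=
  ∀ v w, Connects v w s → Via (StackStep M v w) (StackStep N v w) n s t

theorem Reach.refl (s : List (Layer κ γ)) : Reach M N 0 s s := fun _ _ _ => .refl _

theorem Reach.trans {m n : ℕ} {s t u : List (Layer κ γ)} (h : Reach M N m s t)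
    (h' : Reach M N n t u) : Reach M N (m + n) s u := fun v w hs =>
  (h v w hs).trans (h' v w ((h v w hs).connects hs))

theorem Reach.context {n : ℕ} {s t : List (Layer κ γ)} (h : Reach M N n s t) (hs : s ≠ [])
    (pre post : List (Layer κ γ)) (L R : List (Strand γ)) :
    Reach M N n (pre ++ whisker L R s ++ post) (pre ++ whisker L R t ++ post) := by
  intro v w hc
  obtain ⟨u', h0, h3⟩ := hc.split
  obtain ⟨u, h1, h2'⟩ := h0.split
  obtain ⟨p, q, rfl, rfl, h2⟩ := h2'.unwhisker hs
  clear h2'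
  have key := (h p q h2).bind (k := 1)
    (M' := StackStep M v w) (N' := StackStep N v w)
    (fun s => pre ++ whisker L R s ++ post)
    (fun x y hxy => .counted (n := 0) (.refl _) (hxy.context h1 h3))
    (fun x y hxy => .free (.refl _) (hxy.context h1 h3))
  rwa [Nat.mul_one] at key

theorem StackStep.of_move {v w : List (Strand γ)} {a b : List (Layer κ γ)} (ha : a ≠ [])
    (hab : Parallel a b) (h : M a b ∨ M b a) (pre post : List (Layer κ γ))
    (L R : List (Strand γ)) (hc : Connects v w (pre ++ whisker L R a ++ post)) :
    StackStep M v w (pre ++ whisker L R a ++ post) (pre ++ whisker L R b ++ post) :=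
  ⟨hc, hc.replace ha hab, pre, post, a, b, L, R, h, rfl, rfl⟩

theorem Reach.counted {a b : List (Layer κ γ)} (ha : a ≠ []) (hab : Parallel a b)
    (h : M a b ∨ M b a) (pre post : List (Layer κ γ)) (L R : List (Strand γ)) :
    Reach M N 1 (pre ++ whisker L R a ++ post) (pre ++ whisker L R b ++ post) := fun _ _ hc =>
  .counted (n := 0) (.refl _) (.of_move ha hab h pre post L R hc)

theorem Reach.free {a b : List (Layer κ γ)} (ha : a ≠ []) (hab : Parallel a b)
    (h : N a b ∨ N b a) (pre post : List (Layer κ γ)) (L R : List (Strand γ)) :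
    Reach M N 0 (pre ++ whisker L R a ++ post) (pre ++ whisker L R b ++ post) := fun _ _ hc =>
  .free (.refl _) (.of_move ha hab h pre post L R hc)

end Reach

/-! ### Height exchanges carried out by computation. -/

section Exchange

variable {κ γ : Type} {M : List (Layer κ γ) → List (Layer κ γ) → Prop}

/-- Exchange the heights of two consecutive layers if their pieces lie side by side. -/
def swapPair (x y : Layer κ γ) : List (Layer κ γ) :=
  if x.left.length + x.piece.cod.length ≤ y.left.length then
    let m := y.left.drop (x.left.length + x.piece.cod.length)
    [⟨x.left ++ x.piece.dom ++ m, y.piece, y.right⟩, ⟨x.left, x.piece, m ++ y.piece.cod ++ y.right⟩]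
  else if y.left.length + y.piece.dom.length ≤ x.left.length then
    let m := x.left.drop (y.left.length + y.piece.dom.length)
    [⟨y.left, y.piece, m ++ x.piece.dom ++ x.right⟩, ⟨y.left ++ y.piece.cod ++ m, x.piece, x.right⟩]
  else [x, y]

/-- Exchange the layers number `i` and `i + 1`, if possible. -/
def swapAt : ℕ → List (Layer κ γ) → List (Layer κ γ)
  | 0, x :: y :: s => swapPair x y ++ s
  | i + 1, x :: s => x :: swapAt i s
  | _, s => s

theorem exists_swapAt (i : ℕ) (s : List (Layer κ γ)) : swapAt i s = s ∨
    ∃ pre x y post, s = pre ++ [x, y] ++ post ∧ swapAt i s = pre ++ swapPair x y ++ post := by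
  induction i, s using swapAt.induct with
  | case1 x y s => exact .inr ⟨[], x, y, s, rfl, rfl⟩
  | case2 i x s ih =>
    rcases ih with h | ⟨pre, x', y, post, h1, h2⟩
    · exact .inl (by rw [swapAt, h])
    · refine .inr ⟨x :: pre, x', y, post, by simp [h1], ?_⟩
      rw [swapAt, h2]; simp
  | case3 i s h1 h2 =>
    left
    rcases s with _ | ⟨x, _ | ⟨y, s⟩⟩
    · cases i <;> rfl
    · cases i with
      | zero => rfl
      | succ i => exact absurd rfl (h2 _ _ _ rfl)
    · cases i with
      | zero => exact absurd rfl (h1 _ _ _ rfl)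
      | succ i => exact absurd rfl (h2 _ _ _ rfl)

variable [Turn κ]

theorem Reach.exchange (g h : Piece κ γ) (m : List (Strand γ)) (pre post : List (Layer κ γ))
    (L R : List (Strand γ)) :
    Reach M Planar 0
      (pre ++ [⟨L, g, m ++ h.dom ++ R⟩, ⟨L ++ g.cod ++ m, h, R⟩] ++ post)
      (pre ++ [⟨L ++ g.dom ++ m, h, R⟩, ⟨L, g, m ++ h.cod ++ R⟩] ++ post) := by
  have := Reach.free (M := M) (N := Planar) (by simp)
    (⟨g.dom ++ m ++ h.dom, g.cod ++ m ++ h.cod, by simp [Connects, Layer.dom, Layer.cod],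
      by simp [Connects, Layer.dom, Layer.cod]⟩) (.inl (Planar.exchange g h m)) pre post L R
  simpa [whisker, Layer.whisker] using this

theorem Reach.exchange_symm (g h : Piece κ γ) (m : List (Strand γ)) (pre post : List (Layer κ γ))
    (L R : List (Strand γ)) :
    Reach M Planar 0
      (pre ++ [⟨L ++ g.dom ++ m, h, R⟩, ⟨L, g, m ++ h.cod ++ R⟩] ++ post)
      (pre ++ [⟨L, g, m ++ h.dom ++ R⟩, ⟨L ++ g.cod ++ m, h, R⟩] ++ post) := by
  have := Reach.free (M := M) (N := Planar) (by simp)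
    (⟨g.dom ++ m ++ h.dom, g.cod ++ m ++ h.cod, by simp [Connects, Layer.dom, Layer.cod],
      by simp [Connects, Layer.dom, Layer.cod]⟩) (.inr (Planar.exchange g h m)) pre post L R
  simpa [whisker, Layer.whisker] using this

/-- The level between the layers is both the bottom of `x` and the top of `y`. Comparing prefixes of
this list produces the strands `m` between the two pieces, and the exchange move applies.
Overlapping pieces stay unchanged, so lists of exchanges run without side conditions. -/
theorem Reach.swapPair (pre post : List (Layer κ γ)) (x y : Layer κ γ) :
    Reach M Planar 0 (pre ++ [x, y] ++ post) (pre ++ swapPair x y ++ post) := by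
  intro v w hc
  have hxy : x.cod = y.dom := by
    obtain ⟨_, h1, _⟩ := hc.split
    obtain ⟨_, _, h2⟩ := h1.split
    exact h2.2.1
  obtain ⟨L, g, R⟩ := x
  obtain ⟨L', h, R'⟩ := y
  simp only [Layer.cod, Layer.dom] at hxy
  unfold ColoredDiagrams.swapPair
  split_ifs with h1 h2
  · dsimp only at h1 ⊢
    obtain ⟨m, rfl⟩ : ∃ m, L' = L ++ g.cod ++ m := by
      rw [List.append_assoc L', ← List.length_append] at *
      obtain ⟨m, hm⟩ := List.prefix_of_prefix_length_le ⟨R, hxy⟩ (List.prefix_append _ _) h1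
      exact ⟨m, hm.symm⟩
    have hR : R = m ++ h.dom ++ R' := by
      simpa using hxy
    subst hR
    rw [← List.length_append, List.drop_left]
    exact Reach.exchange g h m pre post L R' v w hc
  · dsimp only at h2 ⊢
    obtain ⟨m, rfl⟩ : ∃ m, L = L' ++ h.dom ++ m := by
      rw [List.append_assoc L, ← List.length_append] at *
      obtain ⟨m, hm⟩ := List.prefix_of_prefix_length_le ⟨R', hxy.symm⟩ (List.prefix_append _ _) h2
      exact ⟨m, hm.symm⟩
    have hR : R' = m ++ g.cod ++ R := by
      simpa using hxy.symm
    subst hR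
    rw [← List.length_append, List.drop_left]
    exact Reach.exchange_symm h g m pre post L' R v w hc
  · exact .refl _

theorem Reach.swapAt (i : ℕ) (s : List (Layer κ γ)) :
    Reach M Planar 0 s (ColoredDiagrams.swapAt i s) := by
  rcases exists_swapAt i s with h | ⟨pre, x, y, post, h1, h2⟩
  · rw [h]; exact .refl _
  · rw [h2, h1]; exact .swapPair pre post x y

/-- Successive exchanges of layers. -/
theorem Reach.swaps (l : List ℕ) (s : List (Layer κ γ)) :
    Reach M Planar 0 s (l.foldl (fun s i => ColoredDiagrams.swapAt i s) s) := by
  induction l generalizing s with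
  | nil => exact .refl _
  | cons i l ih => exact (Reach.swapAt i s).trans (ih _)

end Exchange

/-! ### Deforming consecutive layers at a given position. -/

section Replace

variable {κ γ : Type} {M N : List (Layer κ γ) → List (Layer κ γ) → Prop}

/-- Replace the `n` layers from number `i` on by `t`. -/
def replaceAt : ℕ → ℕ → List (Layer κ γ) → List (Layer κ γ) → List (Layer κ γ)
  | 0, n, t, s => t ++ s.drop n
  | _ + 1, _, t, [] => t
  | i + 1, n, t, x :: s => x :: replaceAt i n t s

theorem replaceAt_eq (i n : ℕ) (t s : List (Layer κ γ)) :
    replaceAt i n t s = s.take i ++ t ++ (s.drop i).drop n := by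
  induction i generalizing s with
  | zero => rfl
  | succ i ih =>
    cases s with
    | nil => simp [replaceAt]
    | cons x s => simp [replaceAt, ih]

/-- Apply a deformation inside a stack, to the layers from number `i` on. -/
theorem Reach.at {n : ℕ} {a b : List (Layer κ γ)} (h : Reach M N n a b) (ha : a ≠ []) (i : ℕ)
    (L R : List (Strand γ)) (s : List (Layer κ γ))
    (hs : (s.drop i).take a.length = whisker L R a) :
    Reach M N n s (replaceAt i a.length (whisker L R b) s) := by
  have key := h.context ha (s.take i) ((s.drop i).drop a.length) L R
  rw [← hs, List.append_assoc, List.take_append_drop, List.take_append_drop] at key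
  rwa [replaceAt_eq]

theorem Reach.of_counted {a b : List (Layer κ γ)} (ha : a ≠ []) (hab : Parallel a b)
    (h : M a b ∨ M b a) : Reach M N 1 a b := by
  simpa [whisker_nil_nil] using Reach.counted (M := M) (N := N) ha hab h [] [] [] []

theorem Reach.of_free {a b : List (Layer κ γ)} (ha : a ≠ []) (hab : Parallel a b)
    (h : N a b ∨ N b a) : Reach M N 0 a b := by
  simpa [whisker_nil_nil] using Reach.free (M := M) (N := N) ha hab h [] [] [] []

theorem Reach.of_eq {s t : List (Layer κ γ)} (h : s = t) : Reach M N 0 s t := h ▸ .refl s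

end Replace

/-! ### Sliding whole stacks past each other. -/

section StackExchange

variable {κ γ : Type} [Turn κ] {M : List (Layer κ γ) → List (Layer κ γ) → Prop}

theorem Reach.exchange_layer_stack (x : Layer κ γ) (m : List (Strand γ)) {q q' : List (Strand γ)}
    {H : List (Layer κ γ)} (hH : Connects q q' H) :
    Reach M Planar 0 (x.whisker [] (m ++ q) :: whisker (x.cod ++ m) [] H)
      (whisker (x.dom ++ m) [] H ++ [x.whisker [] (m ++ q')]) := by
  induction H generalizing q with
  | nil => cases hH; exact .refl _
  | cons y H ih =>
    obtain ⟨rfl, hH⟩ := hH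
    have h1 : Reach M Planar 0 (x.whisker [] (m ++ y.dom) :: whisker (x.cod ++ m) [] (y :: H))
        (y.whisker (x.dom ++ m) [] :: x.whisker [] (m ++ y.cod) :: whisker (x.cod ++ m) [] H) := by
      have := Reach.exchange (M := M) x.piece y.piece (x.right ++ m ++ y.left) []
        (whisker (x.cod ++ m) [] H) x.left y.right
      simpa [whisker, Layer.whisker, Layer.dom, Layer.cod] using this
    have h2 := (ih hH).context (by simp) [y.whisker (x.dom ++ m) []] [] [] []
    rw [whisker_nil_nil, whisker_nil_nil] at h2
    refine Reach.trans (m := 0) (n := 0) h1 ?_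
    simpa [whisker] using h2

/-- The layers of `G` pass `H` one at a time, the lowest first. -/
theorem Reach.exchange_stacks (m : List (Strand γ)) {p p' q q' : List (Strand γ)}
    {G H : List (Layer κ γ)} (hG : Connects p p' G) (hH : Connects q q' H) :
    Reach M Planar 0 (whisker [] (m ++ q) G ++ whisker (p' ++ m) [] H)
      (whisker (p ++ m) [] H ++ whisker [] (m ++ q') G) := by
  induction G generalizing p with
  | nil => cases hG; exact Reach.of_eq (by simp [whisker])
  | cons x G ih =>
    obtain ⟨rfl, hG⟩ := hG
    -- `Reach.context` needs a nonempty stack; if both stacks are empty there is nothing to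
    -- exchange.
    by_cases hGH : whisker [] (m ++ q) G ++ whisker (p' ++ m) [] H = []
    · obtain ⟨rfl, rfl⟩ : G = [] ∧ H = [] := by simpa [whisker] using hGH
      cases hH
      exact .refl _
    · have h1 := (ih hG).context hGH [x.whisker [] (m ++ q)] [] [] []
      have h2 := (Reach.exchange_layer_stack (M := M) x m hH).context (by simp) []
        (whisker [] (m ++ q') G) [] []
      simp only [whisker_nil_nil, List.append_nil, List.nil_append] at h1 h2
      refine Reach.trans (m := 0) (n := 0) (t := x.whisker [] (m ++ q) ::
        (whisker (x.cod ++ m) [] H ++ whisker [] (m ++ q') G)) ?_ ?_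
      · simpa [whisker] using h1
      · simpa [whisker] using h2

end StackExchange

/-! ### Doubled planar isotopies. -/

section Doubling

variable {M : List CLayer → List CLayer → Prop}

theorem dbl_append (v w : List (Strand Unit)) : dbl (v ++ w) = dbl v ++ dbl w :=
  List.flatMap_append

theorem Reach.dbl_exchange (g h : Piece RealCrossing Unit) (m : List (Strand Unit)) :
    Reach M Planar 0
      ([⟨[], g, m ++ h.dom⟩, ⟨g.cod ++ m, h, []⟩].flatMap dblLayer)
      ([⟨g.dom ++ m, h, []⟩, ⟨[], g, m ++ h.cod⟩].flatMap dblLayer) := by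
  have := Reach.exchange_stacks (M := M) (dbl m) (connects_dblPiece g) (connects_dblPiece h)
  simp only [List.flatMap_cons, List.flatMap_nil, List.append_nil, dblLayer, dbl_append]
  exact this

theorem Reach.zigzagLeft (x : Strand Thickness) :
    Reach M Planar 0 [⟨[x], .max x.rev, []⟩, ⟨[], .min x, [x]⟩] [] := by
  refine .of_free (by simp) ⟨[x], [x], ?_, rfl⟩ (.inl (.zigzagLeft x))
  rcases x with ⟨_ | _, _⟩ <;> exact ⟨rfl, rfl, rfl⟩

theorem Reach.zigzagRight (x : Strand Thickness) :
    Reach M Planar 0 [⟨[], .max x, [x]⟩, ⟨[x], .min x.rev, []⟩] [] := by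
  refine .of_free (by simp) ⟨[x], [x], ?_, rfl⟩ (.inl (.zigzagRight x))
  rcases x with ⟨_ | _, _⟩ <;> exact ⟨rfl, rfl, rfl⟩

theorem Reach.slideMax (k : VirtCrossing) (x y : Strand Thickness) :
    Reach M Planar 0 [⟨[y], .max x, []⟩, ⟨[], .cross k y x, [x.rev]⟩]
      [⟨[], .max x, [y]⟩, ⟨[x], .cross (Turn.turn k) x.rev y, []⟩] :=
  .of_free (by simp) ⟨[y], [x, y, x.rev], ⟨rfl, rfl, rfl⟩, ⟨rfl, rfl, rfl⟩⟩
    (.inl (.slideMax k x y))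

theorem Reach.slideMin (k : VirtCrossing) (x y : Strand Thickness) :
    Reach M Planar 0 [⟨[], .cross k x y, [x.rev]⟩, ⟨[y], .min x, []⟩]
      [⟨[x], .cross (Turn.turn k) y x.rev, []⟩, ⟨[], .min x, [y]⟩] :=
  .of_free (by simp) ⟨[x, y, x.rev], [y], ⟨rfl, rfl, rfl⟩, ⟨rfl, rfl, rfl⟩⟩
    (.inl (.slideMin k x y))

/-- Reversal interchanges the copies: `copyL x.rev` is `(copyR x).rev`. Hence the outer maximum and
the inner minimum lie on the same copy, and one height exchange makes them adjacent; once this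
zigzag is removed, the other one remains. Splitting on the direction lets these identities hold by
`rfl`. -/
theorem Reach.dbl_zigzagLeft (x : Strand Unit) :
    Reach M Planar 0
      ([⟨[x], .max x.rev, []⟩, ⟨[], .min x, [x]⟩].flatMap dblLayer) [] := by
  rcases x with ⟨_ | _, c⟩
  · refine Reach.trans (m := 0) (n := 0) (Reach.swaps [1] _) ?_
    refine Reach.trans (m := 0) (n := 0)
      ((Reach.zigzagLeft (copyR ⟨.down, c⟩)).at (by simp) 0 [copyL ⟨.down, c⟩] [] _ rfl) ?_
    refine Reach.trans (m := 0) (n := 0)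
      ((Reach.zigzagLeft (copyL ⟨.down, c⟩)).at (by simp) 0 [] [copyR ⟨.down, c⟩] _ rfl) ?_
    exact .of_eq rfl
  · refine Reach.trans (m := 0) (n := 0) (Reach.swaps [1] _) ?_
    refine Reach.trans (m := 0) (n := 0)
      ((Reach.zigzagLeft (copyR ⟨.up, c⟩)).at (by simp) 0 [copyL ⟨.up, c⟩] [] _ rfl) ?_
    refine Reach.trans (m := 0) (n := 0)
      ((Reach.zigzagLeft (copyL ⟨.up, c⟩)).at (by simp) 0 [] [copyR ⟨.up, c⟩] _ rfl) ?_
    exact .of_eq rfl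

theorem Reach.dbl_zigzagRight (x : Strand Unit) :
    Reach M Planar 0
      ([⟨[], .max x, [x]⟩, ⟨[x], .min x.rev, []⟩].flatMap dblLayer) [] := by
  rcases x with ⟨_ | _, c⟩
  · refine Reach.trans (m := 0) (n := 0) (Reach.swaps [1] _) ?_
    refine Reach.trans (m := 0) (n := 0)
      ((Reach.zigzagRight (copyL ⟨.down, c⟩)).at (by simp) 0 [] [copyR ⟨.down, c⟩] _ rfl) ?_
    refine Reach.trans (m := 0) (n := 0)
      ((Reach.zigzagRight (copyR ⟨.down, c⟩)).at (by simp) 0 [copyL ⟨.down, c⟩] [] _ rfl) ?_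
    exact .of_eq rfl
  · refine Reach.trans (m := 0) (n := 0) (Reach.swaps [1] _) ?_
    refine Reach.trans (m := 0) (n := 0)
      ((Reach.zigzagRight (copyL ⟨.up, c⟩)).at (by simp) 0 [] [copyR ⟨.up, c⟩] _ rfl) ?_
    refine Reach.trans (m := 0) (n := 0)
      ((Reach.zigzagRight (copyR ⟨.up, c⟩)).at (by simp) 0 [copyL ⟨.up, c⟩] [] _ rfl) ?_
    exact .of_eq rfl

/-- Each copy of `y` passes the two nested maxima, the outer one first. The right copy of `y` is
nearer to them and goes first. -/
theorem Reach.dbl_slideMax (k : RealCrossing) (x y : Strand Unit) :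
    Reach M Planar 0
      ([⟨[y], .max x, []⟩, ⟨[], .cross k y x, [x.rev]⟩].flatMap dblLayer)
      ([⟨[], .max x, [y]⟩, ⟨[x], .cross (Turn.turn k) x.rev y, []⟩].flatMap dblLayer) := by
  rcases x with ⟨_ | _, c⟩
  · refine Reach.trans (m := 0) (n := 0) (Reach.swaps [1] _) ?_
    refine Reach.trans (m := 0) (n := 0)
      ((Reach.slideMax (.real k) (copyL ⟨.down, c⟩) (copyR y)).at (by simp) 0 [copyL y] [] _ rfl) ?_
    refine Reach.trans (m := 0) (n := 0) (Reach.swaps [2] _) ?_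
    refine Reach.trans (m := 0) (n := 0)
      ((Reach.slideMax (.real k) (copyR ⟨.down, c⟩) (copyR y)).at (by simp)
        3 [copyL ⟨.down, c⟩, copyL y] [(copyL ⟨.down, c⟩).rev] _ rfl) ?_
    refine Reach.trans (m := 0) (n := 0) (Reach.swaps [1] _) ?_
    refine Reach.trans (m := 0) (n := 0)
      ((Reach.slideMax (.real k) (copyL ⟨.down, c⟩) (copyL y)).at (by simp) 0 [] [copyR y] _ rfl) ?_
    refine Reach.trans (m := 0) (n := 0) (Reach.swaps [4] _) ?_
    refine Reach.trans (m := 0) (n := 0)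
      ((Reach.slideMax (.real k) (copyR ⟨.down, c⟩) (copyL y)).at (by simp)
        3 [copyL ⟨.down, c⟩] [copyR y, (copyL ⟨.down, c⟩).rev] _ rfl) ?_
    refine Reach.trans (m := 0) (n := 0) (Reach.swaps [2, 1, 3] _) ?_
    exact .of_eq rfl
  · refine Reach.trans (m := 0) (n := 0) (Reach.swaps [1] _) ?_
    refine Reach.trans (m := 0) (n := 0)
      ((Reach.slideMax (.real k) (copyL ⟨.up, c⟩) (copyR y)).at (by simp) 0 [copyL y] [] _ rfl) ?_
    refine Reach.trans (m := 0) (n := 0) (Reach.swaps [2] _) ?_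
    refine Reach.trans (m := 0) (n := 0)
      ((Reach.slideMax (.real k) (copyR ⟨.up, c⟩) (copyR y)).at (by simp)
        3 [copyL ⟨.up, c⟩, copyL y] [(copyL ⟨.up, c⟩).rev] _ rfl) ?_
    refine Reach.trans (m := 0) (n := 0) (Reach.swaps [1] _) ?_
    refine Reach.trans (m := 0) (n := 0)
      ((Reach.slideMax (.real k) (copyL ⟨.up, c⟩) (copyL y)).at (by simp) 0 [] [copyR y] _ rfl) ?_
    refine Reach.trans (m := 0) (n := 0) (Reach.swaps [4] _) ?_
    refine Reach.trans (m := 0) (n := 0)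
      ((Reach.slideMax (.real k) (copyR ⟨.up, c⟩) (copyL y)).at (by simp)
        3 [copyL ⟨.up, c⟩] [copyR y, (copyL ⟨.up, c⟩).rev] _ rfl) ?_
    refine Reach.trans (m := 0) (n := 0) (Reach.swaps [2, 1, 3] _) ?_
    exact .of_eq rfl

/-- As for maxima, but each copy of `y` now passes the inner minimum before the outer one. -/
theorem Reach.dbl_slideMin (k : RealCrossing) (x y : Strand Unit) :
    Reach M Planar 0
      ([⟨[], .cross k x y, [x.rev]⟩, ⟨[y], .min x, []⟩].flatMap dblLayer)
      ([⟨[x], .cross (Turn.turn k) y x.rev, []⟩, ⟨[], .min x, [y]⟩].flatMap dblLayer) := by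
  rcases x with ⟨_ | _, c⟩
  · refine Reach.trans (m := 0) (n := 0) (Reach.swaps [3] _) ?_
    refine Reach.trans (m := 0) (n := 0)
      ((Reach.slideMin (.real k) (copyR ⟨.down, c⟩) (copyR y)).at (by simp)
        2 [copyL y, copyL ⟨.down, c⟩] [(copyL ⟨.down, c⟩).rev] _ rfl) ?_
    refine Reach.trans (m := 0) (n := 0)
      ((Reach.slideMin (.real k) (copyL ⟨.down, c⟩) (copyR y)).at (by simp) 4 [copyL y] [] _ rfl) ?_
    refine Reach.trans (m := 0) (n := 0) (Reach.swaps [1, 0, 2] _) ?_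
    refine Reach.trans (m := 0) (n := 0)
      ((Reach.slideMin (.real k) (copyR ⟨.down, c⟩) (copyL y)).at (by simp)
        1 [copyL ⟨.down, c⟩] [copyR y, (copyL ⟨.down, c⟩).rev] _ rfl) ?_
    refine Reach.trans (m := 0) (n := 0) (Reach.swaps [3] _) ?_
    refine Reach.trans (m := 0) (n := 0)
      ((Reach.slideMin (.real k) (copyL ⟨.down, c⟩) (copyL y)).at (by simp) 4 [] [copyR y] _ rfl) ?_
    refine Reach.trans (m := 0) (n := 0) (Reach.swaps [2, 3] _) ?_
    exact .of_eq rfl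
  · refine Reach.trans (m := 0) (n := 0) (Reach.swaps [3] _) ?_
    refine Reach.trans (m := 0) (n := 0)
      ((Reach.slideMin (.real k) (copyR ⟨.up, c⟩) (copyR y)).at (by simp)
        2 [copyL y, copyL ⟨.up, c⟩] [(copyL ⟨.up, c⟩).rev] _ rfl) ?_
    refine Reach.trans (m := 0) (n := 0)
      ((Reach.slideMin (.real k) (copyL ⟨.up, c⟩) (copyR y)).at (by simp) 4 [copyL y] [] _ rfl) ?_
    refine Reach.trans (m := 0) (n := 0) (Reach.swaps [1, 0, 2] _) ?_
    refine Reach.trans (m := 0) (n := 0)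
      ((Reach.slideMin (.real k) (copyR ⟨.up, c⟩) (copyL y)).at (by simp)
        1 [copyL ⟨.up, c⟩] [copyR y, (copyL ⟨.up, c⟩).rev] _ rfl) ?_
    refine Reach.trans (m := 0) (n := 0) (Reach.swaps [3] _) ?_
    refine Reach.trans (m := 0) (n := 0)
      ((Reach.slideMin (.real k) (copyL ⟨.up, c⟩) (copyL y)).at (by simp) 4 [] [copyR y] _ rfl) ?_
    refine Reach.trans (m := 0) (n := 0) (Reach.swaps [2, 3] _) ?_
    exact .of_eq rfl

end Doubling

/-! ### Doubled RII and standard RIII moves. -/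

section Moves

variable {M N : List CLayer → List CLayer → Prop}

theorem Reach.zeroTwo (k : RealCrossing) (l r : Strand Thickness) :
    Reach ZeroTwo N 1
      [⟨[], .cross (.real k) l r, []⟩, ⟨[], .cross (.real (Turn.turn k)) r l, []⟩] [] :=
  .of_counted (by simp) ⟨[l, r], [l, r], ⟨rfl, rfl, rfl⟩, rfl⟩ (.inl (.mk k l r))

/-- The doubled crossings are two opposite 2 × 2 grids. The pair where they meet cancels first; one
height exchange then makes the remaining pairs cancel in turn. -/
theorem Reach.dbl_RII (k : RealCrossing) (l r : Strand Unit) :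
    Reach ZeroTwo Planar 4
      ([⟨[], .cross k l r, []⟩, ⟨[], .cross (Turn.turn k) r l, []⟩].flatMap dblLayer) [] := by
  refine Reach.trans (m := 1) (n := 3)
    ((Reach.zeroTwo k (copyL l) (copyR r)).at (by simp) 3 [copyL r] [copyR l] _ rfl) ?_
  refine Reach.trans (m := 0) (n := 3) (Reach.swaps [2] _) ?_
  refine Reach.trans (m := 1) (n := 2)
    ((Reach.zeroTwo k (copyR l) (copyR r)).at (by simp) 3 [copyL l, copyL r] [] _ rfl) ?_
  refine Reach.trans (m := 1) (n := 1)
    ((Reach.zeroTwo k (copyL l) (copyL r)).at (by simp) 1 [] [copyR l, copyR r] _ rfl) ?_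
  refine Reach.trans (m := 1) (n := 0)
    ((Reach.zeroTwo k (copyR l) (copyL r)).at (by simp) 0 [copyL l] [copyR r] _ rfl) ?_
  exact .of_eq rfl

theorem Reach.pachner (a b c : Strand Thickness) :
    Reach Pachner N 1
      (triLeft (.real .rightOver) (outerOnRight b) (.real .rightOver) a b c)
      (triRight (.real .rightOver) (outerOnLeft b) (.real .rightOver) a b c) :=
  .of_counted (by simp [triLeft]) ⟨[a, b, c], [c, b, a], ⟨rfl, rfl, rfl, rfl⟩, ⟨rfl, rfl, rfl, rfl⟩⟩
    (.inl (.mk a b c))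

/-- Strands `a` and `c` cross each other and both copies of `b`, which is on the left of the
crossing of `a` and `c`. -/
def wideTriLeft (a : Strand Thickness) (b : Strand Unit) (c : Strand Thickness) : List CLayer :=
  [⟨[], .cross (.real .rightOver) a (copyL b), [copyR b, c]⟩,
   ⟨[copyL b], .cross (.real .rightOver) a (copyR b), [c]⟩,
   ⟨[copyL b, copyR b], .cross (.real .rightOver) a c, []⟩,
   ⟨[copyL b], .cross (.real .rightOver) (copyR b) c, [a]⟩,
   ⟨[], .cross (.real .rightOver) (copyL b) c, [copyR b, a]⟩]

/-- Strands `a` and `c` cross each other and both copies of `b`, which is on the right of the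
crossing of `a` and `c`. -/
def wideTriRight (a : Strand Thickness) (b : Strand Unit) (c : Strand Thickness) : List CLayer :=
  [⟨[a, copyL b], .cross (.real .rightOver) (copyR b) c, []⟩,
   ⟨[a], .cross (.real .rightOver) (copyL b) c, [copyR b]⟩,
   ⟨[], .cross (.real .rightOver) a c, [copyL b, copyR b]⟩,
   ⟨[c], .cross (.real .rightOver) a (copyL b), [copyR b]⟩,
   ⟨[c, copyL b], .cross (.real .rightOver) a (copyR b), []⟩]

/-- The crossing of `a` and `c` becomes a symmetry between the two copies of `b`, and is real
again after the second Pachner move. -/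
theorem Reach.wide_pachner (a : Strand Thickness) (b : Strand Unit) (c : Strand Thickness) :
    Reach Pachner Planar 2 (wideTriLeft a b c) (wideTriRight a b c) := by
  -- For either direction of `b`, `outerOnLeft (copyR b)` and `outerOnRight (copyL b)` compute to
  -- the symmetry, so the two moves fit together; the types on the outer sides are real.
  rcases b with ⟨_ | _, u⟩
  · refine Reach.trans (m := 1) (n := 1)
      ((Reach.pachner a (copyR ⟨.down, u⟩) c).at (by simp [triLeft])
        1 [copyL ⟨.down, u⟩] [] _ rfl) ?_
    -- These exchanges bring the two crossings on the left copy of `b` next to the symmetry, one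
    -- above and one below.
    refine Reach.trans (m := 0) (n := 1) (Reach.swaps [0, 3] _) ?_
    refine Reach.trans (m := 1) (n := 0)
      ((Reach.pachner a (copyL ⟨.down, u⟩) c).at (by simp [triLeft])
        1 [] [copyR ⟨.down, u⟩] _ rfl) ?_
    exact .of_eq rfl
  · refine Reach.trans (m := 1) (n := 1)
      ((Reach.pachner a (copyR ⟨.up, u⟩) c).at (by simp [triLeft]) 1 [copyL ⟨.up, u⟩] [] _ rfl) ?_
    refine Reach.trans (m := 0) (n := 1) (Reach.swaps [0, 3] _) ?_
    refine Reach.trans (m := 1) (n := 0)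
      ((Reach.pachner a (copyL ⟨.up, u⟩) c).at (by simp [triLeft]) 1 [] [copyR ⟨.up, u⟩] _ rfl) ?_
    exact .of_eq rfl

/-- The doubled strand `b` sweeps from left to right over the 2 × 2 grid of crossings of the copies
of `a` and `c`: leftmost, top, bottom, rightmost. The exchanges only make the five crossings of each
wide triangle consecutive and finally restore the layer order of the doubled diagram. -/
theorem Reach.dbl_RIIIStd (a b c : Strand Unit) :
    Reach Pachner Planar 8
      ((triLeft .rightOver .rightOver .rightOver a b c).flatMap dblLayer)
      ((triRight .rightOver .rightOver .rightOver a b c).flatMap dblLayer) := by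
  refine Reach.trans (m := 0) (n := 8) (Reach.swaps [1, 3, 2, 7, 6, 8, 7] _) ?_
  refine Reach.trans (m := 2) (n := 6)
    ((Reach.wide_pachner (copyL a) b (copyL c)).at (by simp [wideTriLeft])
        3 [] [copyR a, copyR c] _ rfl) ?_
  refine Reach.trans (m := 2) (n := 4)
    ((Reach.wide_pachner (copyR a) b (copyL c)).at (by simp [wideTriLeft])
        0 [copyL a] [copyR c] _ rfl) ?_
  refine Reach.trans (m := 0) (n := 4) (Reach.swaps [7, 6] _) ?_
  refine Reach.trans (m := 2) (n := 2)
    ((Reach.wide_pachner (copyL a) b (copyR c)).at (by simp [wideTriLeft])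
        7 [copyL c] [copyR a] _ rfl) ?_
  refine Reach.trans (m := 0) (n := 2) (Reach.swaps [4, 3] _) ?_
  refine Reach.trans (m := 2) (n := 0)
    ((Reach.wide_pachner (copyR a) b (copyR c)).at (by simp [wideTriLeft])
        4 [copyL c, copyL a] [] _ rfl) ?_
  refine Reach.trans (m := 0) (n := 0) (Reach.swaps [3, 2, 4, 3, 8, 7, 9] _) ?_
  exact .of_eq rfl

end Moves

/-! ### Reducing every RIII move to the standard one. -/

section Conjugation

theorem StackStep.symm {κ γ : Type} {M : List (Layer κ γ) → List (Layer κ γ) → Prop}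
    {v w : List (Strand γ)} {s t : List (Layer κ γ)} (h : StackStep M v w s t) :
    StackStep M v w t s :=
  let ⟨hs, ht, h⟩ := h
  ⟨ht, hs, h.symm⟩

theorem Reach.symm {κ γ : Type} {M N : List (Layer κ γ) → List (Layer κ γ) → Prop} {n : ℕ}
    {s t : List (Layer κ γ)} (h : Reach M N n s t) (ht : t ≠ []) (hst : Parallel s t) :
    Reach M N n t s := by
  intro v w hc
  have hs : Connects v w s := by
    have := Connects.replace (pre := []) (post := []) (L := []) (R := []) ht hst.symm
      (by simpa [whisker_nil_nil] using hc)
    simpa [whisker_nil_nil] using this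
  exact (h v w hs).symm (fun _ _ => .symm) (fun _ _ => .symm)

theorem Reach.cancel (k : RealCrossing) (l r : Strand Unit) :
    Reach RIIIStd RII 0 [⟨[], .cross k l r, []⟩, ⟨[], .cross (Turn.turn k) r l, []⟩] [] :=
  .of_free (by simp) ⟨[l, r], [l, r], ⟨rfl, rfl, rfl⟩, rfl⟩ (.inl (.mk k l r))

/-- The Reidemeister III moves with crossings `kab`, `kac`, `kbc` can be realised by one standard
Reidemeister III move and Reidemeister II moves. -/
def ByOneStd (kab kac kbc : RealCrossing) : Prop :=
  ∀ a b c, Reach RIIIStd RII 1 (triLeft kab kac kbc a b c) (triRight kab kac kbc a b c)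

theorem parallel_tri (kab kac kbc : RealCrossing) (a b c : Strand Unit) :
    Parallel (triLeft kab kac kbc a b c) (triRight kab kac kbc a b c) :=
  ⟨[a, b, c], [c, b, a], ⟨rfl, rfl, rfl, rfl⟩, ⟨rfl, rfl, rfl, rfl⟩⟩

theorem byOneStd_rightOver : ByOneStd .rightOver .rightOver .rightOver := fun a b c =>
  .of_counted (by simp [triLeft]) (parallel_tri _ _ _ a b c) (.inl (.mk a b c))

/-- Conjugate by the crossing of the first two strands. -/
theorem ByOneStd.conj_left {kab kac kbc : RealCrossing} (h : ByOneStd kab kac kbc) :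
    ByOneStd (Turn.turn kab) kbc kac := by
  intro b a c
  -- In `x` the added crossing is inverse to a crossing of the triangle. Cancelling at the top gives
  -- the right side of the new move; applying `h` and then cancelling at the bottom gives its left
  -- side.
  let x : List (Layer RealCrossing Unit) :=
    ⟨[], .cross (Turn.turn kab) b a, [c]⟩ :: triLeft kab kac kbc a b c ++
      [⟨[c], .cross (Turn.turn kab) b a, []⟩]
  have h1 : Reach RIIIStd RII 1 x (triLeft (Turn.turn kab) kbc kac b a c) :=
    Reach.trans (m := 1) (n := 0) ((h a b c).at (by simp [triLeft]) 1 [] [] _ rfl)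
      ((Reach.cancel kab a b).at (by simp) 3 [c] [] _ rfl)
  have h2 : Reach RIIIStd RII 0 x (triRight (Turn.turn kab) kbc kac b a c) := by
    -- A double quarter turn reduces to the identity only on constructors.
    cases kab <;> exact (Reach.cancel _ b a).at (by simp) 0 [] [c] x rfl
  exact Reach.trans (m := 1) (n := 0)
    (h1.symm (by simp [triLeft])
      ⟨[b, a, c], [c, a, b], ⟨rfl, rfl, rfl, rfl, rfl, rfl⟩, ⟨rfl, rfl, rfl, rfl⟩⟩) h2

/-- Conjugate by the crossing of the last two strands. -/
theorem ByOneStd.conj_right {kab kac kbc : RealCrossing} (h : ByOneStd kab kac kbc) :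
    ByOneStd kac kab (Turn.turn kbc) := by
  intro a c b
  let x : List (Layer RealCrossing Unit) :=
    ⟨[a], .cross (Turn.turn kbc) c b, []⟩ :: triRight kab kac kbc a b c ++
      [⟨[], .cross (Turn.turn kbc) c b, [a]⟩]
  have h' := (h a b c).symm (by simp [triRight]) (parallel_tri _ _ _ a b c)
  have h1 : Reach RIIIStd RII 0 x (triLeft kac kab (Turn.turn kbc) a c b) := by
    cases kbc <;> exact (Reach.cancel _ c b).at (by simp) 0 [a] [] x rfl
  have h2 : Reach RIIIStd RII 1 x (triRight kac kab (Turn.turn kbc) a c b) :=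
    Reach.trans (m := 1) (n := 0) (h'.at (by simp [triRight]) 1 [] [] _ rfl)
      ((Reach.cancel kbc b c).at (by simp) 3 [] [a] _ rfl)
  exact Reach.trans (m := 0) (n := 1)
    (h1.symm (by simp [triLeft])
      ⟨[a, c, b], [b, c, a], ⟨rfl, rfl, rfl, rfl, rfl, rfl⟩, ⟨rfl, rfl, rfl, rfl⟩⟩) h2

/-- The acyclic triples are the six height orders of three strands. The two conjugations act on them
as adjacent transpositions, so all six are reached from the standard order; `h` excludes the two
cyclic triples. -/
theorem byOneStd_of_acyclic (kab kac kbc : RealCrossing) (h : kab = kbc → kac = kab) :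
    ByOneStd kab kac kbc := by
  have h0 := byOneStd_rightOver
  cases kab <;> cases kac <;> cases kbc
  · exact h0
  · exact h0.conj_right
  · exact absurd (h rfl) (by simp)
  · exact h0.conj_left.conj_right
  · exact h0.conj_left
  · exact absurd (h rfl) (by simp)
  · exact h0.conj_right.conj_left
  · exact h0.conj_left.conj_right.conj_left

end Conjugation

/-! ### From local deformations to steps of diagrams. -/

section Lifting

/-- Only the nonempty side `s` is ever deformed. A step from `t` to `s`, where `t` may be empty, is
the reverse of a deformation between the two given diagrams. -/
theorem Reach.via_of_step {κ γ : Type} {P M N : List (Layer κ γ) → List (Layer κ γ) → Prop}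
    {n : ℕ} (h : ∀ s t, P s t → s ≠ [] ∧ Reach M N n s t) {v w : List (Strand γ)}
    {D D' : Diagram κ γ v w} (hD : Step P D D') : Via (Step M) (Step N) n D D' := by
  have key : ∀ (E E' : Diagram κ γ v w) (pre post s t : List (Layer κ γ)) (L R : List (Strand γ)),
      P s t → E.layers = pre ++ whisker L R s ++ post → E'.layers = pre ++ whisker L R t ++ post →
      Via (Step M) (Step N) n E E' := by
    rintro ⟨E, hE⟩ ⟨E', hE'⟩ pre post s t L R hst rfl rfl
    obtain ⟨hs, hr⟩ := h s t hst
    exact (hr.context hs pre post L R v w hE).toDiagram hE hE'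
  obtain ⟨pre, post, s, t, L, R, hM | hM, h1, h2⟩ := hD
  · exact key D D' pre post s t L R hM h1 h2
  · exact (key D' D pre post t s L R hM h2 h1).symm (fun _ _ => .symm) (fun _ _ => .symm)

theorem flatMap_dblLayer_whisker (L R : List (Strand Unit)) (s : List (Layer RealCrossing Unit)) :
    (whisker L R s).flatMap dblLayer = whisker (dbl L) (dbl R) (s.flatMap dblLayer) := by
  induction s with
  | nil => rfl
  | cons x s ih =>
    have hx : dblLayer (x.whisker L R) = whisker (dbl L) (dbl R) (dblLayer x) := by
      simp [dblLayer, Layer.whisker, dbl_append, whisker_whisker]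
    have hw : whisker L R (x :: s) = x.whisker L R :: whisker L R s := rfl
    rw [hw, List.flatMap_cons, List.flatMap_cons, whisker_append, ih, hx]

theorem dblLayer_ne_nil (x : Layer RealCrossing Unit) : dblLayer x ≠ [] := by
  rcases x with ⟨L, _ | _ | _, R⟩ <;> simp [dblLayer, dblPiece, whisker]

theorem Reach.via_zeta {P : List (Layer RealCrossing Unit) → List (Layer RealCrossing Unit) → Prop}
    {M N : List CLayer → List CLayer → Prop} {n : ℕ}
    (h : ∀ s t, P s t → s ≠ [] ∧ Reach M N n (s.flatMap dblLayer) (t.flatMap dblLayer))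
    {v w : List (Strand Unit)} {D D' : TangleDiagram v w} (hD : Step P D D') :
    Via (Step M) (Step N) n (zeta D) (zeta D') := by
  refine Reach.via_of_step
    (P := fun s' t' => ∃ s t, P s t ∧ s' = s.flatMap dblLayer ∧ t' = t.flatMap dblLayer) ?_ ?_
  · rintro _ _ ⟨s, t, hst, rfl, rfl⟩
    obtain ⟨hs, hr⟩ := h s t hst
    refine ⟨?_, hr⟩
    obtain ⟨x, s, rfl⟩ := List.exists_cons_of_ne_nil hs
    simp [dblLayer_ne_nil]
  · obtain ⟨pre, post, s, t, L, R, hP, h1, h2⟩ := hD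
    refine ⟨pre.flatMap dblLayer, post.flatMap dblLayer, s.flatMap dblLayer, t.flatMap dblLayer,
      dbl L, dbl R, hP.imp (fun h => ⟨s, t, h, rfl, rfl⟩) (fun h => ⟨t, s, h, rfl, rfl⟩), ?_, ?_⟩
    · simp only [zeta, h1, List.flatMap_append, flatMap_dblLayer_whisker]
    · simp only [zeta, h2, List.flatMap_append, flatMap_dblLayer_whisker]

variable {v w : List (Strand Unit)} {D D' : TangleDiagram v w}

theorem via_zeta_planar (M : List CLayer → List CLayer → Prop) (h : Step Planar D D') :
    Via (Step M) (Step Planar) 0 (zeta D) (zeta D') := by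
  refine Reach.via_zeta ?_ h
  rintro _ _ (⟨g, h, m⟩ | x | x | ⟨k, x, y⟩ | ⟨k, x, y⟩) <;> refine ⟨by simp, ?_⟩
  · exact .dbl_exchange g h m
  · exact .dbl_zigzagLeft x
  · exact .dbl_zigzagRight x
  · exact .dbl_slideMax k x y
  · exact .dbl_slideMin k x y

theorem via_zeta_RII (h : Step RII D D') :
    Via (Step ZeroTwo) (Step Planar) 4 (zeta D) (zeta D') := by
  refine Reach.via_zeta ?_ h
  rintro _ _ ⟨k, l, r⟩
  exact ⟨by simp, .dbl_RII k l r⟩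

theorem via_zeta_RIIIStd (h : Step RIIIStd D D') :
    Via (Step Pachner) (Step Planar) 8 (zeta D) (zeta D') := by
  refine Reach.via_zeta ?_ h
  rintro _ _ ⟨a, b, c⟩
  exact ⟨by simp [triLeft], .dbl_RIIIStd a b c⟩

theorem via_of_RIII (h : Step RIII D D') : Via (Step RIIIStd) (Step RII) 1 D D' := by
  refine Reach.via_of_step ?_ h
  rintro _ _ ⟨kab, kac, kbc, hk, a, b, c⟩
  exact ⟨by simp [triLeft], byOneStd_of_acyclic kab kac kbc hk a b c⟩

/-- The count stays exact because the conjugating RII moves lift to uncounted moves only. -/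
theorem via_zeta_RIII (h : Step RIII D D') :
    Via (Step Pachner) (fun Z Z' => Step Planar Z Z' ∨ Step ZeroTwo Z Z') 8
      (zeta D) (zeta D') :=
  (via_of_RIII h).bind (k := 8) zeta
    (fun _ _ h => (via_zeta_RIIIStd h).mono (fun _ _ => id) (fun _ _ => .inl))
    (fun _ _ h => (via_zeta_RII h).discount (fun _ _ => .inr) (fun _ _ => .inl))

theorem coloredEquiv_of_regularIsotopic (h : RegularIsotopic D D') :
    ColoredEquiv (zeta D) (zeta D') := by
  induction h with
  | refl => exact .refl _
  | symm _ _ _ ih => exact ih.symm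
  | trans _ _ _ _ _ ih ih' => exact ih.trans _ _ _ ih'
  | rel D D' h =>
    rcases h with h | h | h
    · exact (via_zeta_planar Pachner h).eqvGen.mono fun _ _ h =>
        h.imp id fun h => .inr (.inr h)
    · exact (via_zeta_RII h).eqvGen.mono fun _ _ h => .inr (h.imp id fun h => .inr h)
    · exact (via_zeta_RIII h).eqvGen.mono fun _ _ h =>
        h.imp id fun h => h.elim (fun h => .inr (.inr h)) (fun h => .inl h)

end Lifting

end ColoredDiagrams


theorem theorem5p2 (v w : List (ColoredDiagrams.Strand Unit))
    (D D' : ColoredDiagrams.TangleDiagram v w) :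
    (ColoredDiagrams.RegularIsotopic D D' →
      ColoredDiagrams.ColoredEquiv (ColoredDiagrams.zeta D) (ColoredDiagrams.zeta D')) ∧
    (ColoredDiagrams.Step ColoredDiagrams.Planar D D' →
      Relation.EqvGen (ColoredDiagrams.Step ColoredDiagrams.Planar)
        (ColoredDiagrams.zeta D) (ColoredDiagrams.zeta D')) ∧
    (ColoredDiagrams.Step ColoredDiagrams.RII D D' →
      ColoredDiagrams.Via (ColoredDiagrams.Step ColoredDiagrams.ZeroTwo)
        (ColoredDiagrams.Step ColoredDiagrams.Planar) 4
        (ColoredDiagrams.zeta D) (ColoredDiagrams.zeta D')) ∧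
    (ColoredDiagrams.Step ColoredDiagrams.RIIIStd D D' →
      ColoredDiagrams.Via (ColoredDiagrams.Step ColoredDiagrams.Pachner)
        (ColoredDiagrams.Step ColoredDiagrams.Planar) 8
        (ColoredDiagrams.zeta D) (ColoredDiagrams.zeta D')) ∧
    (ColoredDiagrams.Step ColoredDiagrams.RIII D D' →
      ColoredDiagrams.Via (ColoredDiagrams.Step ColoredDiagrams.Pachner)
        (fun Z Z' => ColoredDiagrams.Step ColoredDiagrams.Planar Z Z' ∨
          ColoredDiagrams.Step ColoredDiagrams.ZeroTwo Z Z') 8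
        (ColoredDiagrams.zeta D) (ColoredDiagrams.zeta D')) :=
  ⟨ColoredDiagrams.coloredEquiv_of_regularIsotopic,
    fun h => (ColoredDiagrams.via_zeta_planar ColoredDiagrams.Planar h).eqvGen_of_zero,
    ColoredDiagrams.via_zeta_RII, ColoredDiagrams.via_zeta_RIIIStd, ColoredDiagrams.via_zeta_RIII⟩
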